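/- Let $k\ge 2$ be an integer. An instance of 2-valued makespan minimization with assignment constraints consists of a finite set $J$ of jobs, a finite set $M$ of machines, a size $p_j\in\{1,k\}$ for each job $j$ (small if $p_j=1$, big if $p_j=k$), and a nonempty set $M_j\subseteq M$ of machines on which $j$ may be scheduled. A schedule assigns each job $j$ to a machine in $M_j$; its makespan is the maximum over the machines of the total size of the jobs assigned to that machine; $\mathrm{OPT}$ is the minimum makespan of a schedule. Assume that $\mathrm{OPT}<2k$ if there is at least one big job. For $T\in\mathbb{N}$ consider the network with a source $s$, a node $n_j$ for each job $j$, nodes $v_{i,b}$ and $m_i$ for each machine $i$, a sink $t$, and the following edges: $s\to n_j$ of capacity $p_j$; $n_j\to v_{i,b}$ of capacity $k$ for each big $j$ and each $i\in M_j$; $n_j\to m_i$ of capacity $1$ for each small $j$ and each $i\in M_j$; $v_{i,b}\to m_i$ of capacity $k$; and $m_i\to t$ of capacity $T$. A (real-valued) $s$–$t$ flow is called feasible if its value is $\sum_{j\in J} p_j$. For a flow $f$ let $x_{ij}$ denote the fraction of the flow sent by $s$ to $n_j$ that is routed through $m_i$, i.e. $x_{ij}=f(n_j,v_{i,b})/f(s,n_j)$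 if $j$ is big and $x_{ij}=f(n_j,m_i)/f(s,n_j)$ if $j$ is small. Then there is a least $T\in\mathbb{N}$ for which a feasible flow exists; it satisfies $T\le\mathrm{OPT}$, and for this $T$ the network has a maximum flow that is integral on every edge. For this $T$ and every maximum flow $f$ that is integral on every edge: 1. $f$ is feasible, $\sum_{i\in M} x_{ij}=1$ for every job $j$, $x_{ij}\in\{0,1\}$ for every small job $j$ and every machine $i$, and $x_{ij}$ is a nonnegative integer multiple of $1/k$ for every big job $j$ and every machine $i$. 2. There is a rounding of $x$, that is, a map $\sigma:J\to M$ such that $x_{\sigma(j)j}=1$ for each small job $j$, $x_{\sigma(j)j}\ge 1/k$ for each big job $j$, and distinct big jobs are assigned to distinct machines. 3. Every such rounding $\sigma$ is a schedule, and its makespan is at most $\left(2-\frac1k\right)\mathrm{OPT}$. -/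

import Mathlib

/-! ## Flows in networks with integer capacities -/

/-- `f` is a (real-valued) flow from `s` to `t` in the network on `V` with capacities `c`
(capacity `0` means that there is no edge). -/
structure IsFlow {V : Type*} [Fintype V] (c : V → V → ℕ) (s t : V) (f : V → V → ℝ) : Prop where
  nonneg : ∀ u v, 0 ≤ f u v
  le_cap : ∀ u v, f u v ≤ (c u v : ℝ)
  conserve : ∀ v, v ≠ s → v ≠ t → ∑ u, f u v = ∑ w, f v w

/-- The amount of flow sent from `s`: net flow out of `s`. -/
def flowValue {V : Type*} [Fintype V] (s : V) (f : V → V → ℝ) : ℝ :=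
  ∑ v, f s v - ∑ v, f v s

/-- `f` is a flow whose value is maximum among all flows, integral or not. -/
def IsMaxFlow {V : Type*} [Fintype V] (c : V → V → ℕ) (s t : V) (f : V → V → ℝ) : Prop :=
  IsFlow c s t f ∧ ∀ g, IsFlow c s t g → flowValue s g ≤ flowValue s f

/-- All edge values of `f` are nonnegative integers. -/
def IsIntegralOnEdges {V : Type*} (f : V → V → ℝ) : Prop :=
  ∀ u v, ∃ n : ℕ, f u v = (n : ℝ)

/-! ## Makespan minimization with assignment constraints and job sizes in `{1, k}` -/

/-- An instance with jobs `J` and machines `M`: each job `j` has size `1` (small) or `k` (big)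
and may be scheduled exactly on the machines in the nonempty set `allowed j`. -/
structure TwoValuedInstance (J M : Type*) (k : ℕ) where
  size : J → ℕ
  size_eq : ∀ j, size j = 1 ∨ size j = k
  allowed : J → Finset M
  allowed_nonempty : ∀ j, (allowed j).Nonempty

/-- The nodes of the layered network: the source `s`, a node `n_j` for every job, a node `v_{i,b}`
and a node `m_i` for every machine, and the sink `t`. -/
inductive NetNode (J M : Type*) where
  | source : NetNode J M
  | job : J → NetNode J M
  | bigNode : M → NetNode J M
  | machine : M → NetNode J M
  | sink : NetNode J M
  deriving Fintype

namespace TwoValuedInstance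

variable {J M : Type*} [Fintype J] [Fintype M] [DecidableEq M] {k : ℕ}

/-- The job `j` is big. -/
def IsBig (I : TwoValuedInstance J M k) (j : J) : Prop := I.size j = k

instance (I : TwoValuedInstance J M k) (j : J) : Decidable (I.IsBig j) :=
  inferInstanceAs (Decidable (I.size j = k))

/-- An assignment of all jobs to machines that respects the assignment constraints. -/
def IsSchedule (I : TwoValuedInstance J M k) (σ : J → M) : Prop :=
  ∀ j, σ j ∈ I.allowed j

/-- Total size of the jobs that `σ` assigns to machine `i`. -/
def load (I : TwoValuedInstance J M k) (σ : J → M) (i : M) : ℕ :=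
  ∑ j with σ j = i, I.size j

/-- The maximum load of a machine. -/
def makespan (I : TwoValuedInstance J M k) (σ : J → M) : ℕ :=
  Finset.univ.sup (I.load σ)

/-- The minimum makespan of a schedule. -/
noncomputable def opt (I : TwoValuedInstance J M k) : ℕ :=
  sInf {C : ℕ | ∃ σ, I.IsSchedule σ ∧ I.makespan σ = C}

/-- The optimum is attained by a schedule. -/
theorem exists_schedule_makespan_eq_opt (I : TwoValuedInstance J M k) :
    ∃ σ, I.IsSchedule σ ∧ I.makespan σ = I.opt := by
  have hne : {C : ℕ | ∃ σ, I.IsSchedule σ ∧ I.makespan σ = C}.Nonempty :=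
    ⟨_, fun j => (I.allowed_nonempty j).choose,
      fun j => (I.allowed_nonempty j).choose_spec, rfl⟩
  exact Nat.sInf_mem hne

/-- Capacities of the layered network for the estimate `T` of the makespan. -/
def cap (I : TwoValuedInstance J M k) (T : ℕ) : NetNode J M → NetNode J M → ℕ
  | .source, .job j => I.size j
  | .job j, .bigNode i => if I.IsBig j ∧ i ∈ I.allowed j then k else 0
  | .job j, .machine i => if ¬ I.IsBig j ∧ i ∈ I.allowed j then 1 else 0
  | .bigNode i, .machine i' => if i = i' then k else 0
  | .machine _, .sink => T
  | _, _ => 0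

/-- A feasible flow solution for the estimate `T`: a flow of total amount equal to the sum of
the job sizes. -/
def IsFeasibleFlow (I : TwoValuedInstance J M k) (T : ℕ)
    (f : NetNode J M → NetNode J M → ℝ) : Prop :=
  IsFlow (I.cap T) .source .sink f ∧ flowValue .source f = ∑ j, (I.size j : ℝ)

/-- The fractional assignment given by `f`: the fraction of the flow sent from the source to the
node of job `j` that is routed through machine `i`. For a big job this flow enters machine `i`
through `v_{i,b}`, whose only outgoing edge leads to `m_i`. -/
noncomputable def fraction (I : TwoValuedInstance J M k)
    (f : NetNode J M → NetNode J M → ℝ) (j : J) (i : M) : ℝ :=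
  (if I.IsBig j then f (.job j) (.bigNode i) else f (.job j) (.machine i)) / f .source (.job j)

/-- `σ` is obtained from the fractional assignment `x` by rounding: small jobs stay on the machine
that has all of them, and big jobs are matched to distinct machines such that the machine
of a big job `j` has at least a `1/k` fraction of `j`. -/
def IsRounding (I : TwoValuedInstance J M k) (x : J → M → ℝ) (σ : J → M) : Prop :=
  (∀ j, ¬ I.IsBig j → x j (σ j) = 1) ∧
  (∀ j, I.IsBig j → 1 / (k : ℝ) ≤ x j (σ j)) ∧
  (∀ j j', I.IsBig j → I.IsBig j' → σ j = σ j' → j = j')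

end TwoValuedInstance

open Finset

/-! A feasible flow for `T` amounts to a splitting of the jobs over allowed machines with at most
`k` big units and `T` units in all per machine (`IsSplit`). An optimal schedule is such a splitting
for `T = opt`: since `opt < 2 * k`, no machine holds two big jobs. Hence the least `T` is at most
`opt`.

Two applications of Hall's theorem carry the rest. Matching job units to machine slots makes a
splitting integral (`IsSplit.exists_natCast`), so no general max-flow theorem is needed. Matching
big jobs, of `k` units each, to machines, each absorbing at most `k` big units, gives the rounding
(`IsSplit.exists_isRounding`).

A machine then receives at most one big job, of which it already held a unit, so its load is at most
`T + k - 1` (`IsSplit.load_le`). A big job also forces `k ≤ opt`, so `k - 1 = (1 - 1/k) * k ≤ (1 -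
1/k) * opt`. -/

theorem NetNode.sum_univ {J M A : Type*} [Fintype J] [Fintype M] [AddCommMonoid A]
    (g : NetNode J M → A) :
    ∑ v, g v = g .source + ∑ j, g (.job j) + ∑ i, g (.bigNode i) + ∑ i, g (.machine i)
      + g .sink := by
  let e : (((Unit ⊕ J) ⊕ M) ⊕ M) ⊕ Unit ≃ NetNode J M :=
    { toFun := Sum.elim (Sum.elim (Sum.elim (Sum.elim (fun _ => .source) .job) .bigNode) .machine)
        (fun _ => .sink)
      invFun := fun v => match v with
        | .source => .inl (.inl (.inl (.inl ())))
        | .job j => .inl (.inl (.inl (.inr j)))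
        | .bigNode i => .inl (.inl (.inr i))
        | .machine i => .inl (.inr i)
        | .sink => .inr ()
      left_inv := by rintro ((((_ | _) | _) | _) | _) <;> rfl
      right_inv := by rintro (_ | _ | _ | _ | _) <;> rfl }
  rw [← e.sum_comp]
  simp [Fintype.sum_sum_type, e]

theorem IsFlow.eq_zero {V : Type*} [Fintype V] {c : V → V → ℕ} {s t : V} {f : V → V → ℝ}
    (hf : IsFlow c s t f) {u v : V} (h : c u v = 0) : f u v = 0 :=
  le_antisymm (by simpa [h] using hf.le_cap u v) (hf.nonneg u v)

/-! ### Splittings of the jobs over the machines -/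

namespace TwoValuedInstance

section

variable {J M : Type*} {k : ℕ}

/-- The amount of job `j` that the flow `f` sends through machine `i`. -/
def routed (I : TwoValuedInstance J M k) (f : NetNode J M → NetNode J M → ℝ) (j : J) (i : M) : ℝ :=
  if I.IsBig j then f (.job j) (.bigNode i) else f (.job j) (.machine i)

theorem size_of_not_isBig {I : TwoValuedInstance J M k} {j : J} (h : ¬ I.IsBig j) :
    I.size j = 1 :=
  (I.size_eq j).resolve_right h

theorem size_ne_zero (I : TwoValuedInstance J M k) (hk : 1 < k) (j : J) : I.size j ≠ 0 := by
  rcases I.size_eq j with h | h <;> omega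

theorem exists_routed_eq_natCast (I : TwoValuedInstance J M k)
    {f : NetNode J M → NetNode J M → ℝ} (hf : IsIntegralOnEdges f) :
    ∃ g : J → M → ℕ, I.routed f = fun j i => (g j i : ℝ) := by
  have : ∀ j i, ∃ n : ℕ, I.routed f j i = n := fun j i => by
    unfold routed
    split_ifs <;> exact hf _ _
  choose g hg using this
  exact ⟨g, funext₂ hg⟩

theorem isRounding_natCast_iff {I : TwoValuedInstance J M k} (hk : 1 < k) {g : J → M → ℕ}
    {σ : J → M} :
    I.IsRounding (fun j i => (g j i : ℝ) / I.size j) σ ↔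
      (∀ j, ¬ I.IsBig j → g j (σ j) = 1) ∧ (∀ j, I.IsBig j → 1 ≤ g j (σ j)) ∧
      ∀ j j', I.IsBig j → I.IsBig j' → σ j = σ j' → j = j' := by
  have hk0 : (0 : ℝ) < k := by positivity
  refine and_congr (forall₂_congr fun j hj => ?_) (and_congr_left' (forall₂_congr fun j hj => ?_))
  · simp [size_of_not_isBig hj]
  · beta_reduce
    rw [show I.size j = k from hj, div_le_div_iff_of_pos_right hk0]
    exact_mod_cast Iff.rfl

variable [Fintype J] [Fintype M]

/-- `h j i` is the amount of job `j` on machine `i` in a splitting of the jobs with at most `k`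
units of big jobs and at most `T` units of all jobs on every machine. -/
structure IsSplit (I : TwoValuedInstance J M k) (T : ℕ) (h : J → M → ℝ) : Prop where
  nonneg : ∀ j i, 0 ≤ h j i
  allowed : ∀ j i, h j i ≠ 0 → i ∈ I.allowed j
  sum_eq : ∀ j, ∑ i, h j i = I.size j
  big_le : ∀ i, ∑ j with I.IsBig j, h j i ≤ k
  total_le : ∀ i, ∑ j, h j i ≤ T

theorem isSplit_natCast_iff {I : TwoValuedInstance J M k} {T : ℕ} {g : J → M → ℕ} :
    I.IsSplit T (fun j i => (g j i : ℝ)) ↔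
      (∀ j i, g j i ≠ 0 → i ∈ I.allowed j) ∧ (∀ j, ∑ i, g j i = I.size j) ∧
      (∀ i, ∑ j with I.IsBig j, g j i ≤ k) ∧ ∀ i, ∑ j, g j i ≤ T := by
  constructor
  · intro h
    exact ⟨fun j i hg => h.allowed j i (by exact_mod_cast hg),
      fun j => by exact_mod_cast h.sum_eq j, fun i => by exact_mod_cast h.big_le i,
      fun i => by exact_mod_cast h.total_le i⟩
  · rintro ⟨h1, h2, h3, h4⟩
    exact ⟨fun _ _ => Nat.cast_nonneg _, fun j i hg => h1 j i (by exact_mod_cast hg),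
      fun j => by exact_mod_cast h2 j, fun i => by exact_mod_cast h3 i,
      fun i => by exact_mod_cast h4 i⟩

theorem IsSplit.isSchedule {I : TwoValuedInstance J M k} (hk : 1 < k) {T : ℕ} {g : J → M → ℕ}
    (hg : I.IsSplit T (fun j i => (g j i : ℝ))) {σ : J → M}
    (hσ : I.IsRounding (fun j i => (g j i : ℝ) / I.size j) σ) : I.IsSchedule σ := by
  obtain ⟨hs, hb, -⟩ := (isRounding_natCast_iff hk).1 hσ
  intro j
  refine (isSplit_natCast_iff.1 hg).1 j _ ?_
  by_cases hj : I.IsBig j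
  · exact Nat.one_le_iff_ne_zero.1 (hb j hj)
  · simp [hs j hj]

end

/-! ### Correspondence between splittings and feasible flows -/

variable {J M : Type*} [Fintype J] [Fintype M] [DecidableEq M] {k : ℕ}

/-- The flow that routes `g j i` units of job `j` through machine `i`. -/
def splitFlow (I : TwoValuedInstance J M k) (g : J → M → ℕ) : NetNode J M → NetNode J M → ℕ
  | .source, .job j => ∑ i, g j i
  | .job j, .bigNode i => if I.IsBig j then g j i else 0
  | .job j, .machine i => if I.IsBig j then 0 else g j i
  | .bigNode i, .machine i' => if i = i' then ∑ j with I.IsBig j, g j i else 0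
  | .machine i, .sink => ∑ j, g j i
  | _, _ => 0

theorem IsSplit.isFeasibleFlow {I : TwoValuedInstance J M k} {T : ℕ} {g : J → M → ℕ}
    (hg : I.IsSplit T (fun j i => (g j i : ℝ))) :
    I.IsFeasibleFlow T (fun u v => (I.splitFlow g u v : ℝ)) := by
  obtain ⟨h1, h2, h3, h4⟩ := isSplit_natCast_iff.1 hg
  have hle : ∀ j i, g j i ≤ I.size j := fun j i =>
    h2 j ▸ single_le_sum (f := fun i => g j i) (fun _ _ => Nat.zero_le _) (mem_univ i)
  refine ⟨⟨fun _ _ => Nat.cast_nonneg _, fun u v => Nat.cast_le.2 ?_, fun v hs ht => ?_⟩, ?_⟩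
  · rcases u with _ | j | i | i | _ <;> rcases v with _ | j' | i' | i' | _ <;>
      simp only [splitFlow, cap, le_refl]
    · exact (h2 j').le
    · by_cases hb : I.IsBig j
      · by_cases ha : i' ∈ I.allowed j
        · simpa [hb, ha] using (hle j i').trans_eq hb
        · simpa [hb, ha] using not_imp_comm.1 (h1 j i') ha
      · simp [hb]
    · by_cases hb : I.IsBig j
      · simp [hb]
      · by_cases ha : i' ∈ I.allowed j
        · simpa [hb, ha] using (hle j i').trans_eq ((I.size_eq j).resolve_right hb)
        · simpa [hb, ha] using not_imp_comm.1 (h1 j i') ha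
    · split_ifs
      · exact h3 i
      · exact le_rfl
    · exact h4 i
  · rw [← Nat.cast_sum, ← Nat.cast_sum, Nat.cast_inj]
    rcases v with _ | j | i | i | _
    · exact absurd rfl hs
    · by_cases hb : I.IsBig j <;> simp [NetNode.sum_univ, splitFlow, hb]
    · simp [NetNode.sum_univ, splitFlow, sum_filter]
    · simp only [NetNode.sum_univ, splitFlow, sum_const_zero, add_zero, zero_add, sum_ite_eq',
        mem_univ, if_true, sum_filter, ← sum_add_distrib]
      exact sum_congr rfl fun j _ => by split_ifs <;> simp
    · exact absurd rfl ht
  · simp only [flowValue, NetNode.sum_univ, splitFlow, h2]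
    simp

theorem flowValue_source {I : TwoValuedInstance J M k} {T : ℕ}
    {f : NetNode J M → NetNode J M → ℝ} (hf : IsFlow (I.cap T) .source .sink f) :
    flowValue .source f = ∑ j, f .source (.job j) := by
  have h0 : ∀ v, f v .source = 0 := fun v => hf.eq_zero (by cases v <;> rfl)
  have h1 : f .source .sink = 0 := hf.eq_zero rfl
  have h2 : ∀ i, f .source (.bigNode i) = 0 := fun i => hf.eq_zero rfl
  have h3 : ∀ i, f .source (.machine i) = 0 := fun i => hf.eq_zero rfl
  simp [flowValue, NetNode.sum_univ, h0, h1, h2, h3]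

theorem flowValue_le {I : TwoValuedInstance J M k} {T : ℕ}
    {f : NetNode J M → NetNode J M → ℝ} (hf : IsFlow (I.cap T) .source .sink f) :
    flowValue .source f ≤ ∑ j, (I.size j : ℝ) := by
  rw [flowValue_source hf]
  exact sum_le_sum fun j _ => hf.le_cap .source (.job j)

theorem IsFeasibleFlow.isMaxFlow {I : TwoValuedInstance J M k} {T : ℕ}
    {f : NetNode J M → NetNode J M → ℝ} (hf : I.IsFeasibleFlow T f) :
    IsMaxFlow (I.cap T) .source .sink f :=
  ⟨hf.1, fun _ hg => (flowValue_le hg).trans_eq hf.2.symm⟩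

theorem IsFeasibleFlow.of_isMaxFlow {I : TwoValuedInstance J M k} {T : ℕ}
    {f g : NetNode J M → NetNode J M → ℝ} (hg : I.IsFeasibleFlow T g)
    (hf : IsMaxFlow (I.cap T) .source .sink f) : I.IsFeasibleFlow T f :=
  ⟨hf.1, le_antisymm (flowValue_le hf.1) (hg.2.symm.trans_le (hf.2 g hg.1))⟩

/-- The value equals the total capacity of the source edges, so each of them is saturated. This
identifies the denominator in `fraction`. -/
theorem IsFeasibleFlow.source_job {I : TwoValuedInstance J M k} {T : ℕ}
    {f : NetNode J M → NetNode J M → ℝ} (hf : I.IsFeasibleFlow T f) (j : J) :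
    f .source (.job j) = I.size j :=
  (sum_eq_sum_iff_of_le fun j _ => hf.1.le_cap .source (.job j)).1
    ((flowValue_source hf.1).symm.trans hf.2) j (mem_univ j)

/-- Conservation at `n_j` gives the job totals; at `v_{i,b}` and `m_i` it turns the capacities `k`
and `T` of their outgoing edges into the two machine bounds. -/
theorem IsFeasibleFlow.isSplit_routed {I : TwoValuedInstance J M k} {T : ℕ}
    {f : NetNode J M → NetNode J M → ℝ} (hf : I.IsFeasibleFlow T f) :
    I.IsSplit T (I.routed f) := by
  have hF := hf.1
  have hjb : ∀ j i, ¬ I.IsBig j → f (.job j) (.bigNode i) = 0 := fun j i hb =>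
    hF.eq_zero (by simp [cap, hb])
  have hjm : ∀ j i, I.IsBig j → f (.job j) (.machine i) = 0 := fun j i hb =>
    hF.eq_zero (by simp [cap, hb])
  have hbig : ∀ i, ∑ j with I.IsBig j, I.routed f j i = f (.bigNode i) (.machine i) := by
    intro i
    have h1 : ∑ u, f u (.bigNode i) = ∑ j, f (.job j) (.bigNode i) := by
      have e1 : f .source (.bigNode i) = 0 := hF.eq_zero rfl
      have e2 : ∀ i', f (.bigNode i') (.bigNode i) = 0 := fun _ => hF.eq_zero rfl
      have e3 : ∀ i', f (.machine i') (.bigNode i) = 0 := fun _ => hF.eq_zero rfl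
      have e4 : f .sink (.bigNode i) = 0 := hF.eq_zero rfl
      simp [NetNode.sum_univ, e1, e2, e3, e4]
    have h2 : ∑ u, f (.bigNode i) u = f (.bigNode i) (.machine i) :=
      sum_eq_single _ (fun v _ hv => hF.eq_zero (by
        rcases v with _ | _ | _ | i' | _ <;> simp_all [cap, eq_comm])) (by simp)
    rw [← h2, ← hF.conserve _ (by simp) (by simp), h1, sum_filter]
    exact sum_congr rfl fun j _ => by by_cases hb : I.IsBig j <;> simp [routed, hb, hjb]
  refine ⟨fun j i => ?_, fun j i h => ?_, fun j => ?_, fun i => ?_, fun i => ?_⟩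
  · unfold routed; split_ifs <;> exact hF.nonneg _ _
  · by_contra ha
    exact h (by unfold routed; split_ifs <;> exact hF.eq_zero (by simp [cap, ha]))
  · have h1 : ∑ u, f u (.job j) = f .source (.job j) :=
      sum_eq_single _ (fun v _ hv => hF.eq_zero (by
        rcases v with _ | _ | _ | _ | _ <;> simp_all [cap])) (by simp)
    have h2 : ∑ u, f (.job j) u = ∑ i, I.routed f j i := by
      have e1 : f (.job j) .source = 0 := hF.eq_zero rfl
      have e2 : ∀ j', f (.job j) (.job j') = 0 := fun _ => hF.eq_zero rfl
      have e3 : f (.job j) .sink = 0 := hF.eq_zero rfl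
      by_cases hb : I.IsBig j <;> simp [NetNode.sum_univ, routed, e1, e2, e3, hb, hjb, hjm]
    rw [← h2, ← hF.conserve _ (by simp) (by simp), h1, hf.source_job]
  · simpa [hbig, cap] using hF.le_cap (.bigNode i) (.machine i)
  · have h1 : ∑ u, f (.machine i) u = f (.machine i) .sink :=
      sum_eq_single _ (fun v _ hv => hF.eq_zero (by
        rcases v with _ | _ | _ | _ | _ <;> simp_all [cap])) (by simp)
    have h2 : ∑ u, f u (.machine i) = ∑ j, I.routed f j i := by
      have e1 : f .source (.machine i) = 0 := hF.eq_zero rfl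
      have e2 : ∑ i', f (.bigNode i') (.machine i) = f (.bigNode i) (.machine i) :=
        sum_eq_single _ (fun i' _ hi => hF.eq_zero (by simp [cap, hi])) (by simp)
      have e3 : ∀ i', f (.machine i') (.machine i) = 0 := fun _ => hF.eq_zero rfl
      have e4 : f .sink (.machine i) = 0 := hF.eq_zero rfl
      simp only [NetNode.sum_univ, e1, e2, e3, e4, ← hbig, sum_const_zero, add_zero, zero_add,
        sum_filter, ← sum_add_distrib]
      exact sum_congr rfl fun j _ => by by_cases hb : I.IsBig j <;> simp [routed, hb, hjm]
    rw [← h2, hF.conserve _ (by simp) (by simp), h1]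
    exact hF.le_cap (.machine i) .sink

/-- A fractional splitting of the jobs can be replaced by an integral one: by Hall's theorem the
units of the jobs can be matched to the `T` slots of the machines, where units of big jobs only use
the first `k` slots. -/
theorem IsSplit.exists_natCast {I : TwoValuedInstance J M k} {T : ℕ} {h : J → M → ℝ}
    (hh : I.IsSplit T h) : ∃ g : J → M → ℕ, I.IsSplit T (fun j i => (g j i : ℝ)) := by
  classical
  let slots : J → M → Finset (Fin T) := fun j i =>
    if i ∈ I.allowed j then univ.filter fun a => I.IsBig j → (a : ℕ) < k else ∅
  let t : (Σ j, Fin (I.size j)) → Finset (M × Fin T) := fun u =>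
    univ.filter fun s => s.2 ∈ slots u.1 s.1
  have hall : ∀ A : Finset (Σ j, Fin (I.size j)), #A ≤ #(A.biUnion t) := by
    intro A
    -- All units of a job have the same neighbours, so only the set of jobs occurring in `A`
    -- matters.
    set B := A.image Sigma.fst with hB
    have hA : #A ≤ ∑ j ∈ B, I.size j := by
      calc #A ≤ #(B.sigma fun j => (univ : Finset (Fin (I.size j)))) :=
            card_le_card fun u hu => mem_sigma.2 ⟨mem_image_of_mem _ hu, mem_univ _⟩
        _ = _ := by simp
    have hU : #(A.biUnion t) = ∑ i, #(B.biUnion fun j => slots j i) := by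
      have : A.biUnion t = (univ.sigma fun i => B.biUnion fun j => slots j i).map
          (Equiv.sigmaEquivProd M (Fin T)).toEmbedding := by
        ext ⟨i, a⟩
        simp [t, hB]
      rw [this, card_map, card_sigma]
    -- A small job of `B` allowed on `i` opens all `T` slots. If only big jobs of `B` are allowed
    -- there, `min k T` slots are open and both bounds on `h` apply. Otherwise `B` has no mass on
    -- `i`.
    have hi : ∀ i, ∑ j ∈ B, h j i ≤ #(B.biUnion fun j => slots j i) := by
      intro i
      have hT : ∑ j ∈ B, h j i ≤ T :=
        (sum_le_univ_sum_of_nonneg fun j => hh.nonneg j i).trans (hh.total_le i)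
      by_cases hs : ∃ j ∈ B, ¬ I.IsBig j ∧ i ∈ I.allowed j
      · obtain ⟨j, hjB, hjb, hja⟩ := hs
        have : (univ : Finset (Fin T)) ⊆ B.biUnion fun j => slots j i := fun a _ =>
          mem_biUnion.2 ⟨j, hjB, by simp [slots, hja, hjb]⟩
        have := card_le_card this
        rw [card_univ, Fintype.card_fin] at this
        exact hT.trans (by exact_mod_cast this)
      push Not at hs
      by_cases hb : ∃ j ∈ B, i ∈ I.allowed j
      · obtain ⟨j, hjB, hja⟩ := hb
        have hsub : (univ : Finset (Fin (min k T))).map (Fin.castLEEmb (min_le_right k T)) ⊆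
            B.biUnion fun j => slots j i := by
          intro a ha
          obtain ⟨b, -, rfl⟩ := mem_map.1 ha
          have := b.2
          exact mem_biUnion.2 ⟨j, hjB, by simp [slots, hja]; omega⟩
        have := card_le_card hsub
        rw [card_map, card_univ, Fintype.card_fin] at this
        have hkB : ∑ j ∈ B, h j i ≤ k := by
          refine le_trans ?_ (hh.big_le i)
          rw [sum_filter]
          refine le_trans (sum_le_sum fun j hj => ?_) (sum_le_univ_sum_of_nonneg fun j => ?_)
          · by_cases hjb : I.IsBig j
            · simp [hjb]
            · simpa [hjb] using (not_imp_comm.1 (hh.allowed j i) (hs j hj hjb)).le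
          · split_ifs
            exacts [hh.nonneg j i, le_rfl]
        exact (le_min hkB hT).trans (by exact_mod_cast this)
      · push Not at hb
        rw [sum_eq_zero fun j hj => not_imp_comm.1 (hh.allowed j i) (hb j hj)]
        positivity
    rw [hU]
    refine hA.trans ?_
    have : ((∑ j ∈ B, I.size j : ℕ) : ℝ) ≤ (∑ i, #(B.biUnion fun j => slots j i) : ℕ) := by
      push_cast
      rw [sum_congr rfl fun j _ => (hh.sum_eq j).symm, sum_comm]
      exact sum_le_sum fun i _ => hi i
    exact_mod_cast this
  obtain ⟨φ, hφ, hφt⟩ := (all_card_le_biUnion_card_iff_exists_injective t).1 hall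
  have hmem : ∀ u, (φ u).1 ∈ I.allowed u.1 ∧ (I.IsBig u.1 → ((φ u).2 : ℕ) < k) := by
    intro u
    have := hφt u
    simp only [t, slots, mem_filter, mem_univ, true_and] at this
    split_ifs at this with ha
    · exact ⟨ha, by simpa using this⟩
    · simp at this
  -- On a fixed machine, `φ` is injective in the slot number. This is used with `n = k` for the big
  -- jobs and `n = T` for all jobs.
  have hcard : ∀ (i : M) (S : Finset J) (n : ℕ), (∀ u, u.1 ∈ S → ((φ u).2 : ℕ) < n) →
      ∑ j ∈ S, #{a : Fin (I.size j) | (φ ⟨j, a⟩).1 = i} ≤ n := by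
    intro i S n hS
    rw [← card_sigma, ← card_range n]
    refine card_le_card_of_injOn (fun u => ((φ u).2 : ℕ)) (fun u hu => ?_) fun u hu v hv huv => ?_
    · have hu' := mem_sigma.1 hu
      exact mem_coe.2 (mem_range.2 (hS u hu'.1))
    · have hu' := (mem_filter.1 (mem_sigma.1 hu).2).2
      have hv' := (mem_filter.1 (mem_sigma.1 hv).2).2
      exact hφ (Prod.ext (hu'.trans hv'.symm) (Fin.ext huv))
  refine ⟨fun j i => #{a : Fin (I.size j) | (φ ⟨j, a⟩).1 = i}, isSplit_natCast_iff.2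
    ⟨fun j i hji => ?_, fun j => ?_, fun i => hcard i _ _ fun u hu => ?_,
      fun i => hcard i _ _ fun u _ => (φ u).2.2⟩⟩
  · obtain ⟨a, ha⟩ := card_ne_zero.1 hji
    exact (mem_filter.1 ha).2 ▸ (hmem ⟨j, a⟩).1
  · rw [← card_eq_sum_card_fiberwise (fun a _ => mem_coe.2 (mem_univ _))]
    simp
  · exact (hmem u).2 (mem_filter.1 hu).2

/-! ### Comparison with the optimum, and rounding -/

theorem load_le_makespan (I : TwoValuedInstance J M k) (σ : J → M) (i : M) :
    I.load σ i ≤ I.makespan σ :=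
  le_sup (f := I.load σ) (mem_univ i)

theorem IsBig.le_opt {I : TwoValuedInstance J M k} {j : J} (hj : I.IsBig j) : k ≤ I.opt := by
  obtain ⟨σ, -, h⟩ := I.exists_schedule_makespan_eq_opt
  refine le_trans ?_ ((I.load_le_makespan σ (σ j)).trans_eq h)
  exact (show k = I.size j from hj.symm).trans_le
    (single_le_sum (f := I.size) (fun _ _ => Nat.zero_le _) (by simp))

theorem exists_isSplit_opt (I : TwoValuedInstance J M k)
    (hopt : (∃ j, I.IsBig j) → I.opt < 2 * k) :
    ∃ g : J → M → ℕ, I.IsSplit I.opt (fun j i => (g j i : ℝ)) := by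
  obtain ⟨σ, hσ, h⟩ := I.exists_schedule_makespan_eq_opt
  have hload : ∀ i, ∑ j, (if σ j = i then I.size j else 0) ≤ I.opt := fun i => by
    rw [← sum_filter]
    exact (I.load_le_makespan σ i).trans_eq h
  refine ⟨fun j i => if σ j = i then I.size j else 0, isSplit_natCast_iff.2
    ⟨fun j i hji => ?_, fun j => by simp, fun i => ?_, hload⟩⟩
  · exact (ite_ne_right_iff.1 hji).1 ▸ hσ j
  · have hle := (sum_le_univ_sum_of_nonneg (s := univ.filter I.IsBig)
      fun j => Nat.zero_le (if σ j = i then I.size j else 0)).trans (hload i)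
    -- The big load is a multiple of `k`, so being below `2 * k` forces it to be at most `k`.
    have hmul : ∑ j with I.IsBig j, (if σ j = i then I.size j else 0) =
        #{j ∈ univ.filter I.IsBig | σ j = i} * k := by
      rw [← sum_filter, ← smul_eq_mul, ← sum_const]
      exact sum_congr rfl fun j hj => (mem_filter.1 (mem_filter.1 hj).1).2
    rw [hmul] at hle ⊢
    by_cases hb : ∃ j, I.IsBig j
    · have := lt_of_mul_lt_mul_right (hle.trans_lt (hopt hb)) (Nat.zero_le k)
      exact (Nat.mul_le_mul_right k (Nat.lt_succ_iff.1 this)).trans_eq (one_mul k)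
    · push Not at hb
      simp [hb]

/-- Hall's condition by double counting: a set `A` of big jobs places all its `#A * k` units on its
neighbours, each of which takes at most `k`. By integrality, a neighbour holds at least one unit,
that is, a `1/k` fraction. -/
theorem IsSplit.exists_isRounding {I : TwoValuedInstance J M k} (hk : 1 < k) {T : ℕ}
    {g : J → M → ℕ} (hg : I.IsSplit T (fun j i => (g j i : ℝ))) :
    ∃ σ, I.IsRounding (fun j i => (g j i : ℝ) / I.size j) σ := by
  classical
  obtain ⟨-, hsum, hbig, -⟩ := isSplit_natCast_iff.1 hg
  have hall : ∀ A : Finset {j // I.IsBig j},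
      #A ≤ #(A.biUnion fun j => univ.filter fun i => g j i ≠ 0) := by
    intro A
    set N := A.biUnion fun j => univ.filter fun i => g j i ≠ 0 with hN
    refine Nat.le_of_mul_le_mul_right ?_ (by omega : 0 < k)
    calc #A * k = ∑ j ∈ A, ∑ i ∈ N, g j i := by
          rw [← smul_eq_mul, ← sum_const]
          refine sum_congr rfl fun j hj => ?_
          refine (show k = I.size j from j.2.symm).trans ((hsum j).symm.trans ?_)
          refine (sum_subset (subset_univ N) fun i _ hi => ?_).symm
          by_contra h0
          exact hi (mem_biUnion.2 ⟨j, hj, by simpa using h0⟩)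
      _ = ∑ i ∈ N, ∑ j ∈ A, g j i := sum_comm
      _ ≤ ∑ _i ∈ N, k := by
          refine sum_le_sum fun i _ => ?_
          refine le_trans ?_ (hbig i)
          rw [← sum_subtype_eq_sum_filter]
          exact sum_le_sum_of_subset fun j _ => by simp
      _ = #N * k := by simp
  obtain ⟨φ, hφ, hφg⟩ := (all_card_le_biUnion_card_iff_exists_injective _).1 hall
  have hsmall : ∀ j, ¬ I.IsBig j → ∃ i, g j i = 1 := by
    intro j hj
    have h1 : ∑ i, g j i = 1 := (hsum j).trans (size_of_not_isBig hj)
    obtain ⟨i, -, hi⟩ := exists_ne_zero_of_sum_ne_zero (h1.trans_ne one_ne_zero)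
    have := single_le_sum (f := g j) (fun _ _ => Nat.zero_le _) (mem_univ i)
    exact ⟨i, by omega⟩
  choose s hs using hsmall
  refine ⟨fun j => if hj : I.IsBig j then φ ⟨j, hj⟩ else s j hj, (isRounding_natCast_iff hk).2
    ⟨fun j hj => by simpa [hj] using hs j hj, fun j hj => ?_, fun j j' hj hj' h => ?_⟩⟩
  · simpa [hj, Nat.one_le_iff_ne_zero] using hφg ⟨j, hj⟩
  · simp only [hj, hj', dite_true] at h
    exact congrArg Subtype.val (hφ h)

/-- A machine gains at most `k - 1` units by rounding, and nothing if it receives no big job. -/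
theorem IsSplit.load_le {I : TwoValuedInstance J M k} (hk : 1 < k) {T : ℕ} {g : J → M → ℕ}
    (hg : I.IsSplit T (fun j i => (g j i : ℝ))) {σ : J → M}
    (hσ : I.IsRounding (fun j i => (g j i : ℝ) / I.size j) σ) (i : M) :
    I.load σ i ≤ T ∨ (∃ j, I.IsBig j) ∧ I.load σ i + 1 ≤ T + k := by
  classical
  obtain ⟨hs, hb, hinj⟩ := (isRounding_natCast_iff hk).1 hσ
  have hT := (isSplit_natCast_iff.1 hg).2.2.2 i
  have hle : ∀ j, ¬ I.IsBig j → (if σ j = i then I.size j else 0) ≤ g j i := by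
    intro j hj
    split_ifs with h
    · rw [← h, hs j hj, size_of_not_isBig hj]
    · exact Nat.zero_le _
  unfold load
  rw [sum_filter]
  by_cases hi : ∃ j, I.IsBig j ∧ σ j = i
  · obtain ⟨j, hj, rfl⟩ := hi
    refine .inr ⟨⟨j, hj⟩, ?_⟩
    have h1 := hb j hj
    have h2 : ∑ j' ∈ univ.erase j, (if σ j' = σ j then I.size j' else 0) ≤
        ∑ j' ∈ univ.erase j, g j' (σ j) := by
      refine sum_le_sum fun j' hj' => ?_
      by_cases hbj : I.IsBig j'
      · have : σ j' ≠ σ j := fun h => (mem_erase.1 hj').1 (hinj _ _ hbj hj h)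
        simp [this]
      · exact hle j' hbj
    -- The big job `j` already contributes at least one unit to the sum bounded by `T`, so raising
    -- its share to `k` adds at most `k - 1`.
    rw [← add_sum_erase _ _ (mem_univ j)] at hT ⊢
    have h3 : I.size j = k := hj
    simp only [if_true]
    omega
  · push Not at hi
    refine .inl (le_trans (sum_le_sum fun j _ => ?_) hT)
    by_cases hj : I.IsBig j
    · simp [hi j hj]
    · exact hle j hj

theorem IsSplit.makespan_le {I : TwoValuedInstance J M k} (hk : 1 < k) {T : ℕ}
    (hTopt : T ≤ I.opt) {g : J → M → ℕ} (hg : I.IsSplit T (fun j i => (g j i : ℝ))) {σ : J → M}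
    (hσ : I.IsRounding (fun j i => (g j i : ℝ) / I.size j) σ) :
    (I.makespan σ : ℝ) ≤ (2 - 1 / (k : ℝ)) * I.opt := by
  have hk1 : (1 : ℝ) < k := by exact_mod_cast hk
  have hinv : 1 / (k : ℝ) ≤ 1 := by rw [div_le_one (by linarith)]; exact hk1.le
  have hrhs : (2 - 1 / (k : ℝ)) * I.opt = I.opt + (1 - 1 / (k : ℝ)) * I.opt := by ring
  have hpos : 0 ≤ (1 - 1 / (k : ℝ)) * I.opt :=
    mul_nonneg (by linarith) (Nat.cast_nonneg _)
  have hload : ∀ i, (I.load σ i : ℝ) ≤ (2 - 1 / (k : ℝ)) * I.opt := by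
    intro i
    have hTopt' : (T : ℝ) ≤ I.opt := by exact_mod_cast hTopt
    rcases hg.load_le hk hσ i with h | ⟨⟨j, hj⟩, h⟩
    · have : (I.load σ i : ℝ) ≤ T := by exact_mod_cast h
      linarith
    · have h1 : (I.load σ i : ℝ) + 1 ≤ T + k := by exact_mod_cast h
      have h2 : (k : ℝ) ≤ I.opt := by exact_mod_cast hj.le_opt
      have h3 := mul_le_mul_of_nonneg_left h2 (sub_nonneg.2 hinv)
      have h4 : (1 - 1 / (k : ℝ)) * k = k - 1 := by field_simp
      linarith
  -- The makespan is a supremum in `ℕ`, so the real bound is passed through its floor; an empty `M`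
  -- needs no separate case.
  refine le_trans ?_ (Nat.floor_le (by linarith [Nat.cast_nonneg (α := ℝ) I.opt]))
  exact Nat.cast_le.2 (Finset.sup_le fun i _ => Nat.le_floor (hload i))

theorem IsFeasibleFlow.fraction_eq {I : TwoValuedInstance J M k} {T : ℕ}
    {f : NetNode J M → NetNode J M → ℝ} (hf : I.IsFeasibleFlow T f) :
    I.fraction f = fun j i => I.routed f j i / I.size j := by
  funext j i
  rw [fraction, hf.source_job, routed]

end TwoValuedInstance

theorem mainTheorem3 {J M : Type*} [Fintype J] [Fintype M] [DecidableEq M] {k : ℕ} (hk : 1 < k)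
    (I : TwoValuedInstance J M k) (hopt : (∃ j, I.IsBig j) → I.opt < 2 * k) :
    ∃ T : ℕ, IsLeast {T' : ℕ | ∃ f, I.IsFeasibleFlow T' f} T ∧ T ≤ I.opt ∧
      (∃ f, IsMaxFlow (I.cap T) .source .sink f ∧ IsIntegralOnEdges f) ∧
      ∀ f, IsMaxFlow (I.cap T) .source .sink f → IsIntegralOnEdges f →
        I.IsFeasibleFlow T f ∧
        (∀ j, ∑ i, I.fraction f j i = 1) ∧
        (∀ j i, ¬ I.IsBig j → I.fraction f j i = 0 ∨ I.fraction f j i = 1) ∧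
        (∀ j i, I.IsBig j → ∃ n : ℕ, I.fraction f j i = (n : ℝ) / (k : ℝ)) ∧
        (∃ σ, I.IsRounding (I.fraction f) σ) ∧
        ∀ σ, I.IsRounding (I.fraction f) σ →
          I.IsSchedule σ ∧ (I.makespan σ : ℝ) ≤ (2 - 1 / (k : ℝ)) * (I.opt : ℝ) := by
  obtain ⟨g₀, hg₀⟩ := I.exists_isSplit_opt hopt
  have hmem : I.opt ∈ {T' : ℕ | ∃ f, I.IsFeasibleFlow T' f} := ⟨_, hg₀.isFeasibleFlow⟩
  have hleast := isLeast_csInf ⟨_, hmem⟩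
  set T := sInf {T' : ℕ | ∃ f, I.IsFeasibleFlow T' f}
  have hT : T ≤ I.opt := hleast.2 hmem
  obtain ⟨f₁, hf₁⟩ := hleast.1
  refine ⟨T, hleast, hT, ?_, fun f hmax hint => ?_⟩
  · obtain ⟨g, hg⟩ := hf₁.isSplit_routed.exists_natCast
    exact ⟨_, hg.isFeasibleFlow.isMaxFlow, fun u v => ⟨_, rfl⟩⟩
  -- A maximum flow has at least the value of the feasible flow `f₁`, and no flow exceeds the total
  -- job size.
  have hf := hf₁.of_isMaxFlow hmax
  obtain ⟨g, hgf⟩ := I.exists_routed_eq_natCast hint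
  have hg := hgf ▸ hf.isSplit_routed
  have hsize : ∀ j, (I.size j : ℝ) ≠ 0 := fun j => Nat.cast_ne_zero.2 (I.size_ne_zero hk j)
  rw [hf.fraction_eq, hgf]
  refine ⟨hf, fun j => ?_, fun j i hj => ?_, fun j i hj => ⟨g j i, ?_⟩, hg.exists_isRounding hk,
    fun σ hσ => ⟨hg.isSchedule hk hσ, hg.makespan_le hk hT hσ⟩⟩
  · rw [← sum_div, hg.sum_eq, div_self (hsize j)]
  · have h1 : ∑ i, g j i = 1 :=
      ((TwoValuedInstance.isSplit_natCast_iff.1 hg).2.1 j).trans (TwoValuedInstance.size_of_not_isBig hj)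
    have h2 := h1 ▸ single_le_sum (f := g j) (fun _ _ => Nat.zero_le _) (mem_univ i)
    rcases Nat.le_one_iff_eq_zero_or_eq_one.1 h2 with h | h <;> simp [h, TwoValuedInstance.size_of_not_isBig hj]
  · beta_reduce
    rw [show I.size j = k from hj]
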